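/- Let $G$ be a real or complex Lie group with identity element $e$ (finite-dimensional or, more generally, modelled on a Banach space), and let $A\colon G\to G$ be a smooth map (holomorphic, in the complex case) which is an averaging operator on $G$, that is, $$A(g)A(h)=A(A(g)h)=A(gA(h))\qquad\text{for all } g,h\in G.$$ Assume that $A(e)=e$. Let $\mathfrak g=T_eG$ be the Lie algebra of $G$, and let $A_{*e}\colon\mathfrak g\to\mathfrak g$ be the tangent map of $A$ at $e$. Then $(\mathfrak g,A_{*e})$ is an averaging Lie algebra, that is, the linear operator $A_{*e}$ satisfies $$[A_{*e}(u),A_{*e}(v)]=A_{*e}\big([A_{*e}(u),v]\big)\qquad\text{for all } u,v\in\mathfrak g.$$ -/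

import Mathlib

open scoped Manifold ContDiff

/-- A map `A` on a group `G` is an *averaging operator* if
`A(g)A(h) = A(A(g)h) = A(gA(h))` for all `g, h`; then `(G, A)` is an averaging group. -/
def IsAveragingGroup {G : Type*} [Group G] (A : G → G) : Prop :=
  ∀ g h : G, A g * A h = A (A g * h) ∧ A g * A h = A (g * A h)

/-- `(L, A)` is an *averaging Lie algebra*: the linear operator `A` on the Lie algebra `L`
satisfies `[A(a), A(b)] = A([A(a), b])` for all `a, b`. -/
def IsAveragingLieAlgebra {R L : Type*} [CommRing R] [LieRing L] [LieAlgebra R L]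
    (A : L →ₗ[R] L) : Prop :=
  ∀ a b : L, ⁅A a, A b⁆ = A ⁅A a, b⁆

section LieGroups

variable {𝕜 : Type*} [RCLike 𝕜] {E : Type*} [NormedAddCommGroup E] [NormedSpace 𝕜 E]
  {H : Type*} [TopologicalSpace H] (I : ModelWithCorners 𝕜 E H)
  {G : Type*} [TopologicalSpace G] [ChartedSpace H G] [Group G]

/-- A smooth Lie group has the (lower) regularity under which Mathlib provides the Lie algebra
structure on its tangent space at the identity. -/
instance instLieGroupMinSmoothness [LieGroup I ∞ G] : LieGroup I (minSmoothness 𝕜 3) G :=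
  LieGroup.of_le (n := ∞) (by
    rw [minSmoothness_of_isRCLikeNormedField]
    exact WithTop.coe_le_coe.2 (le_top : (3 : ℕ∞) ≤ ⊤))

/-- `(G, A)` is an *averaging Lie group*: `A` is a smooth averaging operator on the Lie
group `G`. -/
structure IsAveragingLieGroup [LieGroup I ∞ G] (A : G → G) : Prop where
  averaging : IsAveragingGroup A
  smooth : ContMDiff I I ∞ A

/-- The tangent map `T_e G → T_e G` at the identity of a map `A : G → G` with `A(e) = e`: the
derivative `T_e G → T_{A(e)} G`, with its codomain transported along `A(e) = e`. -/
noncomputable def tangentMapAtOne (A : G → G) (hA : A 1 = 1) :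
    GroupLieAlgebra I G →L[𝕜] GroupLieAlgebra I G :=
  cast (congrArg (fun y : G => TangentSpace I (1 : G) →L[𝕜] TangentSpace I y) hA)
    (mfderiv I I A 1)

end LieGroups

/-! ### The infinitesimal identity, as calculus in a normed space. -/

section Calculus

open Filter Topology

variable {𝕜 : Type*} [RCLike 𝕜] {E : Type*} [NormedAddCommGroup E] [NormedSpace 𝕜 E]

/-! In the chart at `e`, let `a` be `A`, `T = Da(e)`, `L x` the derivative at `e` of left
translation by `x`, and `B = DL(e)`; the Lie bracket is `B(v, w) - B(w, v)`. Differentiating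
`A(g)A(h) = A(A(g)h)` and `A(g)A(h) = A(gA(h))` in `h` at `e` gives the hypotheses `hleft` and
`hright` of `fderiv_bracket_of_averaging`. Differentiating these in `g` at `e` gives `B(Tu, Tv) =
D²a(Tu, v) + T B(Tu, v)` and `B(Tv, Tu) = D²a(v, Tu) + T B(v, Tu)`. In the difference the second
derivatives of `a` cancel by symmetry, leaving `[Tu, Tv] = T[Tu, v]`. Both averaging identities are
thus needed for one bracket identity. -/

/-- Let `L : E → (E →L[𝕜] E)` be the derivative at the neutral element of left translations in a
local group, written in coordinates. If `D a` satisfies the differentiated averaging identities,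
then `D a` at the neutral element is averaging for the bracket `D L v w - D L w v`. -/
theorem fderiv_bracket_of_averaging {a : E → E} {L : E → E →L[𝕜] E} {x₀ : E}
    (ha : ContDiffAt 𝕜 2 a x₀) (hL : DifferentiableAt 𝕜 L x₀) (ha₀ : a x₀ = x₀)
    (hL₀ : L x₀ = ContinuousLinearMap.id 𝕜 E)
    (hleft : ∀ᶠ x in 𝓝 x₀, (L (a x)).comp (fderiv 𝕜 a x₀) = (fderiv 𝕜 a (a x)).comp (L (a x)))
    (hright : ∀ᶠ x in 𝓝 x₀,
      (L (a x)).comp (fderiv 𝕜 a x₀) = (fderiv 𝕜 a x).comp ((L x).comp (fderiv 𝕜 a x₀)))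
    (u v : E) :
    fderiv 𝕜 L x₀ (fderiv 𝕜 a x₀ u) (fderiv 𝕜 a x₀ v)
        - fderiv 𝕜 L x₀ (fderiv 𝕜 a x₀ v) (fderiv 𝕜 a x₀ u) =
      fderiv 𝕜 a x₀ (fderiv 𝕜 L x₀ (fderiv 𝕜 a x₀ u) v - fderiv 𝕜 L x₀ v (fderiv 𝕜 a x₀ u)) := by
  have hda : DifferentiableAt 𝕜 a x₀ := ha.differentiableAt (by norm_num)
  have hD : DifferentiableAt 𝕜 (fderiv 𝕜 a) x₀ :=
    (ha.fderiv_right (m := 1) (by norm_num)).differentiableAt (by norm_num)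
  have hsymm : IsSymmSndFDerivAt 𝕜 a x₀ :=
    ha.isSymmSndFDerivAt (by rw [minSmoothness_of_isRCLikeNormedField])
  set T := fderiv 𝕜 a x₀ with hT
  have hLa : HasFDerivAt (fun x => L (a x)) ((fderiv 𝕜 L x₀).comp T) x₀ := by
    have h : HasFDerivAt L (fderiv 𝕜 L x₀) (a x₀) := by rw [ha₀]; exact hL.hasFDerivAt
    exact h.comp x₀ hda.hasFDerivAt
  have hDa : HasFDerivAt (fun x => fderiv 𝕜 a (a x)) ((fderiv 𝕜 (fderiv 𝕜 a) x₀).comp T) x₀ := by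
    have h : HasFDerivAt (fderiv 𝕜 a) (fderiv 𝕜 (fderiv 𝕜 a) x₀) (a x₀) := by
      rw [ha₀]; exact hD.hasFDerivAt
    exact h.comp x₀ hda.hasFDerivAt
  have hlhs := hLa.clm_comp (hasFDerivAt_const T x₀)
  have h1 := hlhs.unique ((hDa.clm_comp hLa).congr_of_eventuallyEq hleft)
  have h2 := hlhs.unique
    ((hD.hasFDerivAt.clm_comp
      (hL.hasFDerivAt.clm_comp (hasFDerivAt_const T x₀))).congr_of_eventuallyEq
      hright)
  -- The arguments are swapped in the second identity so that both second-derivative terms involve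
  -- the pair `T u`, `v`.
  have e1 := congrArg (fun f => f u v) h1
  have e2 := congrArg (fun f => f v u) h2
  simp [ha₀, hL₀, ← hT] at e1 e2
  rw [e1, e2, hsymm.eq (T u) v, map_sub]
  abel

end Calculus

/-! ### Multiplication and `A` in the chart at the identity. -/

section LieGroupCoordinates

open Filter Topology Set VectorField

variable {𝕜 : Type*} [RCLike 𝕜] {E : Type*} [NormedAddCommGroup E] [NormedSpace 𝕜 E]
  {H : Type*} [TopologicalSpace H] (I : ModelWithCorners 𝕜 E H)
  {G : Type*} [TopologicalSpace G] [ChartedSpace H G] [Group G]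

variable (G) in
/-- The multiplication of a Lie group, read in the preferred chart at the identity. -/
noncomputable def mulInChartAtOne (x y : E) : E :=
  extChartAt I (1 : G) ((extChartAt I (1 : G)).symm x * (extChartAt I (1 : G)).symm y)

/-- A self-map of a Lie group, read in the preferred chart at the identity. -/
noncomputable def mapInChartAtOne (A : G → G) (x : E) : E :=
  extChartAt I (1 : G) (A ((extChartAt I (1 : G)).symm x))

variable (G) in
/-- The derivative at the identity of left translations, read in the preferred chart at the
identity. -/
noncomputable def leftTranslationInChartAtOne (x : E) : E →L[𝕜] E :=
  fderiv 𝕜 (mulInChartAtOne I G x) (extChartAt I (1 : G) 1)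

theorem mapInChartAtOne_apply_base {A : G → G} (hA1 : A 1 = 1) :
    mapInChartAtOne I A (extChartAt I (1 : G) 1) = extChartAt I (1 : G) 1 := by
  simp [mapInChartAtOne, hA1]

theorem mulInChartAtOne_base_right {x : E} (hx : x ∈ (extChartAt I (1 : G)).target) :
    mulInChartAtOne I G x (extChartAt I (1 : G) 1) = x := by
  rw [mulInChartAtOne, extChartAt_to_inv, mul_one, (extChartAt I (1 : G)).right_inv hx]

theorem mulInChartAtOne_base_left {y : E} (hy : y ∈ (extChartAt I (1 : G)).target) :
    mulInChartAtOne I G (extChartAt I (1 : G) 1) y = y := by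
  rw [mulInChartAtOne, extChartAt_to_inv, one_mul, (extChartAt I (1 : G)).right_inv hy]

variable [I.Boundaryless]

theorem leftTranslationInChartAtOne_base :
    leftTranslationInChartAtOne I G (extChartAt I (1 : G) 1) = ContinuousLinearMap.id 𝕜 E := by
  have h : mulInChartAtOne I G (extChartAt I (1 : G) 1) =ᶠ[𝓝 (extChartAt I (1 : G) 1)] id := by
    filter_upwards [extChartAt_target_mem_nhds (I := I) (1 : G)] with y hy
    exact mulInChartAtOne_base_left I hy
  rw [leftTranslationInChartAtOne, h.fderiv_eq, fderiv_id]

variable [LieGroup I ∞ G]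

theorem contDiffAt_mapInChartAtOne {A : G → G} (hA : ContMDiff I I ∞ A) {x : E}
    (hx : x ∈ (extChartAt I (1 : G)).target)
    (hAx : A ((extChartAt I (1 : G)).symm x) ∈ (extChartAt I (1 : G)).source) :
    ContDiffAt 𝕜 ∞ (mapInChartAtOne I A) x := by
  rw [← contMDiffAt_iff_contDiffAt]
  have h1 : ContMDiffAt 𝓘(𝕜, E) I ∞ (extChartAt I (1 : G)).symm x :=
    (contMDiffOn_extChartAt_symm (1 : G)).contMDiffAt
      ((isOpen_extChartAt_target (I := I) (1 : G)).mem_nhds hx)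
  have h2 : ContMDiffAt I 𝓘(𝕜, E) ∞ (extChartAt I (1 : G)) (A ((extChartAt I (1 : G)).symm x)) :=
    contMDiffAt_extChartAt' (by simpa using hAx)
  exact h2.comp x (hA.contMDiffAt.comp x h1)

theorem contDiffAt_mulInChartAtOne {x y : E}
    (hx : x ∈ (extChartAt I (1 : G)).target) (hy : y ∈ (extChartAt I (1 : G)).target)
    (hxy : (extChartAt I (1 : G)).symm x * (extChartAt I (1 : G)).symm y ∈
      (extChartAt I (1 : G)).source) :
    ContDiffAt 𝕜 ∞ (Function.uncurry (mulInChartAtOne I G)) (x, y) := by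
  rw [← contMDiffAt_iff_contDiffAt]
  have h1 : ∀ z ∈ (extChartAt I (1 : G)).target,
      ContMDiffAt 𝓘(𝕜, E) I ∞ (extChartAt I (1 : G)).symm z := fun z hz =>
    (contMDiffOn_extChartAt_symm (1 : G)).contMDiffAt
      ((isOpen_extChartAt_target (I := I) (1 : G)).mem_nhds hz)
  have h2 : ContMDiffAt I 𝓘(𝕜, E) ∞ (extChartAt I (1 : G))
      ((extChartAt I (1 : G)).symm x * (extChartAt I (1 : G)).symm y) :=
    contMDiffAt_extChartAt' (by simpa using hxy)
  have hfst : ContMDiffAt 𝓘(𝕜, E × E) 𝓘(𝕜, E) ∞ (Prod.fst : E × E → E) (x, y) :=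
    contMDiffAt_iff_contDiffAt.2 contDiffAt_fst
  have hsnd : ContMDiffAt 𝓘(𝕜, E × E) 𝓘(𝕜, E) ∞ (Prod.snd : E × E → E) (x, y) :=
    contMDiffAt_iff_contDiffAt.2 contDiffAt_snd
  have h3 := ((h1 x hx).comp (x, y) hfst).mul ((h1 y hy).comp (x, y) hsnd)
  exact h2.comp (x, y) h3

theorem differentiableAt_leftTranslationInChartAtOne :
    DifferentiableAt 𝕜 (leftTranslationInChartAtOne I G) (extChartAt I (1 : G) 1) := by
  have h0 : extChartAt I (1 : G) 1 ∈ (extChartAt I (1 : G)).target := mem_extChartAt_target _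
  have h := contDiffAt_mulInChartAtOne I (G := G) h0 h0 (by
    rw [extChartAt_to_inv, one_mul]; exact mem_extChartAt_source _)
  exact (h.fderiv (m := 1) contDiffAt_const (by
    rw [one_add_one_eq_two]; exact WithTop.coe_le_coe.2 (le_top : (2 : ℕ∞) ≤ ⊤))).differentiableAt
    (by norm_num)

theorem differentiableAt_mulInChartAtOne {x : E} (hx : x ∈ (extChartAt I (1 : G)).target) :
    DifferentiableAt 𝕜 (mulInChartAtOne I G x) (extChartAt I (1 : G) 1) := by
  have h0 : extChartAt I (1 : G) 1 ∈ (extChartAt I (1 : G)).target := mem_extChartAt_target _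
  have h := contDiffAt_mulInChartAtOne I (G := G) hx h0
    (by
    rw [extChartAt_to_inv, mul_one]; exact (extChartAt I (1 : G)).map_target hx)
  exact (h.differentiableAt (by simp)).comp (extChartAt I (1 : G) 1)
    ((differentiableAt_const x).prodMk differentiableAt_id)

/-! ### The Lie bracket and the tangent map in coordinates. -/

/-- The coordinate expression of a left-invariant vector field. -/
theorem mpullbackWithin_mulInvariantVectorField {x : E}
    (hx : x ∈ (extChartAt I (1 : G)).target) (v : GroupLieAlgebra I G) :
    mpullbackWithin 𝓘(𝕜, E) I (extChartAt I (1 : G)).symm (mulInvariantVectorField v) (range I) x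
      = leftTranslationInChartAtOne I G x v := by
  have hsymm : MDifferentiableAt 𝓘(𝕜, E) I (extChartAt I (1 : G)).symm x := by
    have h := mdifferentiableWithinAt_extChartAt_symm (I := I) hx
    rwa [I.range_eq_univ, mdifferentiableWithinAt_univ] at h
  have hM := differentiableAt_mulInChartAtOne I hx
  have hbase := mulInChartAtOne_base_right I hx
  have hφ : MDifferentiableAt I 𝓘(𝕜, E) (extChartAt I (1 : G)) 1 :=
    mdifferentiableAt_extChartAt (mem_chart_source H (1 : G))
  have h1 : HasMFDerivAt I 𝓘(𝕜, E) (extChartAt I (1 : G)) 1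
      (ContinuousLinearMap.id 𝕜 (TangentSpace I (1 : G))) := by
    have h := hφ.hasMFDerivAt
    rwa [mfderiv_extChartAt_self] at h
  have h2 := hM.hasFDerivAt.hasMFDerivAt
  have h3 : HasMFDerivAt 𝓘(𝕜, E) I (extChartAt I (1 : G)).symm
      (mulInChartAtOne I G x (extChartAt I (1 : G) 1))
      (mfderiv 𝓘(𝕜, E) I (extChartAt I (1 : G)).symm x) := by
    rw [hbase]
    exact hsymm.hasMFDerivAt
  have h4 := (h3.comp _ h2).comp (1 : G) h1
  -- Near `1`, left translation factors through the chart, so the chain rule computes its derivative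
  -- there.
  have heq : (fun h : G => (extChartAt I (1 : G)).symm x * h) =ᶠ[𝓝 1]
      ((extChartAt I (1 : G)).symm ∘ mulInChartAtOne I G x) ∘ extChartAt I (1 : G) := by
    have hc : ContinuousAt (fun h : G => (extChartAt I (1 : G)).symm x * h) 1 :=
      (contMDiff_mul_left (I := I) (n := ∞)).continuous.continuousAt
    filter_upwards [extChartAt_source_mem_nhds (I := I) (1 : G),
      hc.eventually_mem (by
        rw [mul_one]
        exact extChartAt_source_mem_nhds' ((extChartAt I (1 : G)).map_target hx))] with h hh hgh
    simp only [Function.comp_apply, mulInChartAtOne]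
    rw [(extChartAt I (1 : G)).left_inv hh, (extChartAt I (1 : G)).left_inv hgh]
  have h5 := (h4.congr_of_eventuallyEq heq).mfderiv
  rw [mpullbackWithin_apply]
  have hinv := isInvertible_mfderivWithin_extChartAt_symm (I := I) hx
  refine hinv.inverse_apply_eq.2 ?_
  rw [I.range_eq_univ, mfderivWithin_univ]
  exact congrArg (fun f : E →L[𝕜] E => f v) h5

/-- Left-invariant fields read `x ↦ L x v` in the chart, and `L` is the identity at the base point,
so the flat bracket of two such fields involves only the derivative of `L`. -/
theorem bracket_eq_fderiv_leftTranslationInChartAtOne (v w : GroupLieAlgebra I G) :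
    (⁅v, w⁆ : GroupLieAlgebra I G) =
      (fderiv 𝕜 (leftTranslationInChartAtOne I G) (extChartAt I (1 : G) 1) v w
        - fderiv 𝕜 (leftTranslationInChartAtOne I G) (extChartAt I (1 : G) 1) w v : E) := by
  have hV : ∀ v : GroupLieAlgebra I G,
      mpullbackWithin 𝓘(𝕜, E) I (extChartAt I (1 : G)).symm (mulInvariantVectorField v) (range I)
        =ᶠ[𝓝 (extChartAt I (1 : G) 1)] fun x => leftTranslationInChartAtOne I G x v := fun v => by
    filter_upwards [extChartAt_target_mem_nhds (I := I) (1 : G)] with x hx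
    exact mpullbackWithin_mulInvariantVectorField I hx v
  have hL := differentiableAt_leftTranslationInChartAtOne I (G := G)
  have hlie : ∀ v w : E, lieBracket 𝕜 (fun x => leftTranslationInChartAtOne I G x v)
      (fun x => leftTranslationInChartAtOne I G x w) (extChartAt I (1 : G) 1) =
      fderiv 𝕜 (leftTranslationInChartAtOne I G) (extChartAt I (1 : G) 1) v w
        - fderiv 𝕜 (leftTranslationInChartAtOne I G) (extChartAt I (1 : G) 1) w v := fun v w => by
    rw [lieBracket_eq]
    simp only [leftTranslationInChartAtOne_base]
    rw [fderiv_clm_apply hL (differentiableAt_const v),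
      fderiv_clm_apply hL (differentiableAt_const w)]
    simp [-extChartAt]
  have hid : ∀ z : E, (mfderiv I 𝓘(𝕜, E) (extChartAt I (1 : G)) 1).inverse z = z := fun z => by
    rw [mfderiv_extChartAt_self]
    exact congrArg (fun f : E →L[𝕜] E => f z) ContinuousLinearMap.inverse_id
  rw [GroupLieAlgebra.bracket_def, ← mlieBracketWithin_univ, mlieBracketWithin_apply]
  refine (hid _).trans ?_
  rw [preimage_univ, univ_inter, I.range_eq_univ]
  rw [I.range_eq_univ] at hV
  refine (congrFun (lieBracketWithin_univ (𝕜 := 𝕜) (E := E)) _).trans ?_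
  refine ((hV v).lieBracket_vectorField_eq (hV w)).trans (hlie v w)

omit [LieGroup I ∞ G] in
theorem tangentMapAtOne_eq_fderiv {A : G → G} (hA : ContMDiff I I ∞ A) (hA1 : A 1 = 1)
    (v : GroupLieAlgebra I G) :
    tangentMapAtOne I A hA1 v =
      fderiv 𝕜 (mapInChartAtOne I A) (extChartAt I (1 : G) 1) v := by
  -- Replacing `A 1` by a variable `y` lets the equation be eliminated, and the transport with it.
  have hcast : ∀ (y : G) (hy : y = 1) (f : E →L[𝕜] E) (v : E),
      (cast (congrArg (fun y : G => TangentSpace I (1 : G) →L[𝕜] TangentSpace I y) hy) f :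
        TangentSpace I (1 : G) →L[𝕜] TangentSpace I (1 : G)) v = f v := by
    rintro y rfl f v
    rfl
  refine (hcast (A 1) hA1 (mfderiv I I A 1) v).trans ?_
  rw [(hA.mdifferentiable (by simp) 1).mfderiv, I.range_eq_univ, fderivWithin_univ]
  simp only [writtenInExtChartAt, hA1]
  rfl

/-! ### The averaging identities differentiated in the second factor. -/

omit [I.Boundaryless] [LieGroup I ∞ G] in
/-- The preimage under a smooth map fixing the identity of the chart domain is a neighbourhood. -/
theorem eventually_mem_extChartAt_source {A : G → G} (hA : ContMDiff I I ∞ A) (hA1 : A 1 = 1) :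
    ∀ᶠ x in 𝓝 (extChartAt I (1 : G) 1),
      A ((extChartAt I (1 : G)).symm x) ∈ (extChartAt I (1 : G)).source := by
  have hc : ContinuousAt (fun x => A ((extChartAt I (1 : G)).symm x)) (extChartAt I (1 : G) 1) :=
    hA.continuous.continuousAt.comp (continuousAt_extChartAt_symm (1 : G))
  refine hc.eventually_mem ?_
  rw [extChartAt_to_inv, hA1]
  exact extChartAt_source_mem_nhds (I := I) (1 : G)

omit [I.Boundaryless] in
theorem eventually_mul_mem_extChartAt_source {x : E} (hx : x ∈ (extChartAt I (1 : G)).target) :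
    ∀ᶠ y in 𝓝 (extChartAt I (1 : G) 1),
      (extChartAt I (1 : G)).symm x * (extChartAt I (1 : G)).symm y ∈
        (extChartAt I (1 : G)).source := by
  have hc : ContinuousAt
      (fun y => (extChartAt I (1 : G)).symm x * (extChartAt I (1 : G)).symm y)
      (extChartAt I (1 : G) 1) :=
    ((contMDiff_mul_left (I := I) (n := ∞)).continuous.continuousAt).comp
      (continuousAt_extChartAt_symm (1 : G))
  refine hc.eventually_mem ?_
  rw [extChartAt_to_inv, mul_one]
  exact extChartAt_source_mem_nhds' ((extChartAt I (1 : G)).map_target hx)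

theorem fderiv_mulInChartAtOne_comp_mapInChartAtOne {A : G → G} (hA : ContMDiff I I ∞ A)
    (hA1 : A 1 = 1) {z : E} (hz : z ∈ (extChartAt I (1 : G)).target) :
    fderiv 𝕜 (fun y => mulInChartAtOne I G z (mapInChartAtOne I A y)) (extChartAt I (1 : G) 1) =
      (leftTranslationInChartAtOne I G z).comp
        (fderiv 𝕜 (mapInChartAtOne I A) (extChartAt I (1 : G) 1)) := by
  have h0 : extChartAt I (1 : G) 1 ∈ (extChartAt I (1 : G)).target := mem_extChartAt_target _
  have hT := (contDiffAt_mapInChartAtOne I hA h0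
    (eventually_mem_extChartAt_source I hA hA1).self_of_nhds).differentiableAt (by simp)
  have hM : HasFDerivAt (mulInChartAtOne I G z) (leftTranslationInChartAtOne I G z)
      (mapInChartAtOne I A (extChartAt I (1 : G) 1)) := by
    rw [mapInChartAtOne_apply_base I hA1]
    exact (differentiableAt_mulInChartAtOne I hz).hasFDerivAt
  exact (hM.comp _ hT.hasFDerivAt).fderiv

theorem fderiv_mapInChartAtOne_comp_mulInChartAtOne {A : G → G} {z : E}
    (hz : z ∈ (extChartAt I (1 : G)).target) (hA : DifferentiableAt 𝕜 (mapInChartAtOne I A) z) :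
    fderiv 𝕜 (fun y => mapInChartAtOne I A (mulInChartAtOne I G z y)) (extChartAt I (1 : G) 1) =
      (fderiv 𝕜 (mapInChartAtOne I A) z).comp (leftTranslationInChartAtOne I G z) := by
  have h : HasFDerivAt (mapInChartAtOne I A) (fderiv 𝕜 (mapInChartAtOne I A) z)
      (mulInChartAtOne I G z (extChartAt I (1 : G) 1)) := by
    rw [mulInChartAtOne_base_right I hz]
    exact hA.hasFDerivAt
  exact (h.comp _ (differentiableAt_mulInChartAtOne I hz).hasFDerivAt).fderiv

theorem leftTranslationInChartAtOne_averaging_left {A : G → G} (hA : IsAveragingLieGroup I A)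
    (hA1 : A 1 = 1) :
    ∀ᶠ x in 𝓝 (extChartAt I (1 : G) 1),
      (leftTranslationInChartAtOne I G (mapInChartAtOne I A x)).comp
          (fderiv 𝕜 (mapInChartAtOne I A) (extChartAt I (1 : G) 1)) =
        (fderiv 𝕜 (mapInChartAtOne I A) (mapInChartAtOne I A x)).comp
          (leftTranslationInChartAtOne I G (mapInChartAtOne I A x)) := by
  -- The derivative of `a` is taken at `a x`, so `A (A g)` must also stay in the chart domain.
  have hAA : ContMDiff I I ∞ (A ∘ A) := hA.smooth.comp hA.smooth
  filter_upwards [eventually_mem_extChartAt_source I hA.smooth hA1,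
    eventually_mem_extChartAt_source I hAA (by simp [hA1])] with x hx hxx
  have hz : mapInChartAtOne I A x ∈ (extChartAt I (1 : G)).target :=
    (extChartAt I (1 : G)).map_source hx
  have hz' : (extChartAt I (1 : G)).symm (mapInChartAtOne I A x) =
      A ((extChartAt I (1 : G)).symm x) := (extChartAt I (1 : G)).left_inv hx
  have hd : DifferentiableAt 𝕜 (mapInChartAtOne I A) (mapInChartAtOne I A x) :=
    (contDiffAt_mapInChartAtOne I hA.smooth hz (by rw [hz']; exact hxx)).differentiableAt (by simp)
  rw [← fderiv_mulInChartAtOne_comp_mapInChartAtOne I hA.smooth hA1 hz,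
    ← fderiv_mapInChartAtOne_comp_mulInChartAtOne I hz hd]
  refine Filter.EventuallyEq.fderiv_eq ?_
  filter_upwards [eventually_mem_extChartAt_source I hA.smooth hA1,
    eventually_mul_mem_extChartAt_source I hz] with y hy hzy
  simp only [mulInChartAtOne, mapInChartAtOne] at hz' hzy ⊢
  rw [(extChartAt I (1 : G)).left_inv hy, (extChartAt I (1 : G)).left_inv hzy, hz',
    (hA.averaging _ _).1]

theorem leftTranslationInChartAtOne_averaging_right {A : G → G} (hA : IsAveragingLieGroup I A)
    (hA1 : A 1 = 1) :
    ∀ᶠ x in 𝓝 (extChartAt I (1 : G) 1),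
      (leftTranslationInChartAtOne I G (mapInChartAtOne I A x)).comp
          (fderiv 𝕜 (mapInChartAtOne I A) (extChartAt I (1 : G) 1)) =
        (fderiv 𝕜 (mapInChartAtOne I A) x).comp ((leftTranslationInChartAtOne I G x).comp
          (fderiv 𝕜 (mapInChartAtOne I A) (extChartAt I (1 : G) 1))) := by
  filter_upwards [eventually_mem_extChartAt_source I hA.smooth hA1,
    extChartAt_target_mem_nhds (I := I) (1 : G)] with x hx hxt
  have hz : mapInChartAtOne I A x ∈ (extChartAt I (1 : G)).target :=
    (extChartAt I (1 : G)).map_source hx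
  have hz' : (extChartAt I (1 : G)).symm (mapInChartAtOne I A x) =
      A ((extChartAt I (1 : G)).symm x) := (extChartAt I (1 : G)).left_inv hx
  have hd : DifferentiableAt 𝕜 (mapInChartAtOne I A) x :=
    (contDiffAt_mapInChartAtOne I hA.smooth hxt hx).differentiableAt (by simp)
  have h0 : extChartAt I (1 : G) 1 ∈ (extChartAt I (1 : G)).target := mem_extChartAt_target _
  have hT := (contDiffAt_mapInChartAtOne I hA.smooth h0
    (eventually_mem_extChartAt_source I hA.smooth hA1).self_of_nhds).differentiableAt
      (by simp)
  have hM := differentiableAt_mulInChartAtOne I hxt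
  have ha0 := mapInChartAtOne_apply_base I hA1
  rw [← fderiv_mulInChartAtOne_comp_mapInChartAtOne I hA.smooth hA1 hz,
    ← ContinuousLinearMap.comp_assoc, ← fderiv_mapInChartAtOne_comp_mulInChartAtOne I hxt hd]
  -- The chain rule for `y ↦ a (x * a y)` needs the outer map at `a e`, which is `e` again.
  have hcomp : DifferentiableAt 𝕜 (fun y => mapInChartAtOne I A (mulInChartAtOne I G x y))
      (mapInChartAtOne I A (extChartAt I (1 : G) 1)) := by
    rw [ha0]
    refine DifferentiableAt.comp (g := mapInChartAtOne I A) _ ?_ hM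
    rwa [mulInChartAtOne_base_right I hxt]
  have hchain := fderiv_comp _ hcomp hT
  rw [ha0] at hchain
  rw [← hchain]
  refine Filter.EventuallyEq.fderiv_eq ?_
  have hcont := hT.continuousAt
  have hev := eventually_mul_mem_extChartAt_source I hxt
  rw [ContinuousAt, ha0] at hcont
  filter_upwards [eventually_mem_extChartAt_source I hA.smooth hA1, hcont.eventually hev]
    with y hy hxy
  simp only [Function.comp_apply, mulInChartAtOne, mapInChartAtOne] at hz' hxy ⊢
  rw [(extChartAt I (1 : G)).left_inv hxy, (extChartAt I (1 : G)).left_inv hy, hz',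
    (hA.averaging _ _).2]

end LieGroupCoordinates

/-! ### Return from coordinates to the Lie algebra. -/

theorem mainTheorem3 {𝕜 : Type*} [RCLike 𝕜]
    {E : Type*} [NormedAddCommGroup E] [NormedSpace 𝕜 E] [CompleteSpace E]
    {H : Type*} [TopologicalSpace H] (I : ModelWithCorners 𝕜 E H) [I.Boundaryless]
    {G : Type*} [TopologicalSpace G] [ChartedSpace H G] [Group G] [LieGroup I ∞ G]
    (A : G → G) (hA : IsAveragingLieGroup I A) (hA1 : A 1 = 1) :
    IsAveragingLieAlgebra (R := 𝕜) (L := GroupLieAlgebra I G)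
      (tangentMapAtOne I A hA1).toLinearMap := by
  intro u v
  simp only [ContinuousLinearMap.coe_coe]
  have h0 : extChartAt I (1 : G) 1 ∈ (extChartAt I (1 : G)).target := mem_extChartAt_target _
  have ha : ContDiffAt 𝕜 ∞ (mapInChartAtOne I A) (extChartAt I (1 : G) 1) :=
    contDiffAt_mapInChartAtOne I hA.smooth h0 (by
      rw [extChartAt_to_inv, hA1]; exact mem_extChartAt_source _)
  have key := fderiv_bracket_of_averaging (ha.of_le (WithTop.coe_le_coe.2 (le_top : (2 : ℕ∞) ≤ ⊤)))
    (differentiableAt_leftTranslationInChartAtOne I (G := G))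
    (mapInChartAtOne_apply_base I hA1) (leftTranslationInChartAtOne_base I)
    (leftTranslationInChartAtOne_averaging_left I hA hA1)
    (leftTranslationInChartAtOne_averaging_right I hA hA1) u v
  simp only [tangentMapAtOne_eq_fderiv I hA.smooth hA1]
  exact (bracket_eq_fderiv_leftTranslationInChartAtOne I _ _).trans (key.trans
    (congrArg (fderiv 𝕜 (mapInChartAtOne I A) (extChartAt I (1 : G) 1))
      (bracket_eq_fderiv_leftTranslationInChartAtOne I _ _)).symm)
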